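/- Let $\mathcal H$ be a finite-dimensional complex Hilbert space, $\mathcal L_{\rm h}$ the real space of Hermitian operators on $\mathcal H$, and $\mathcal S=\mathcal S(\mathcal H)\subset\mathcal L_{\rm h}$ the manifold of strictly positive density operators; its tangent space at each point is identified with $\{A\in\mathcal L_{\rm h} : \mathrm{Tr}\,A=0\}$. Write $\langle A\rangle_\rho=\mathrm{Tr}(\rho A)$. Let $\{\langle\cdot,\cdot\rangle_\rho\}_{\rho\in\mathcal S}$ be a family of inner products on $\mathcal L_{\rm h}$, depending smoothly on $\rho$, with $\langle A,I\rangle_\rho=\langle A\rangle_\rho$ for all $A\in\mathcal L_{\rm h}$. For a tangent vector $u$ at $\rho$ let $L_u\in\mathcal L_{\rm h}$ be determined by $\mathrm{Tr}(uA)=\langle L_u,A\rangle_\rho$ for all $A\in\mathcal L_{\rm h}$, and let $g_\rho(u,v)=\langle L_u,L_v\rangle_\rho$. Let $\nabla^{(\rm m)}$ be the flat connection of $\mathcal S$ as an open subset of the affine space of Hermitian operators of trace one, and let $\nabla^{(\rm e)}$ be its dual connection: $X g(Y,Z)=g(\nabla^{(\rm e)}_XY,Z)+g(Y,\nabla^{(\rm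 m)}_XZ)$ for all vector fields $X,Y,Z$ on $\mathcal S$. Let $(\mathcal M,\xi)$ be an $n$-dimensional model: a connected submanifold $\mathcal M$ of $\mathcal S$ with a global coordinate system $\xi=(\xi^1,\dots,\xi^n)$. Put $\partial_i=\partial/\partial\xi^i$, $L_i=L_{\partial_i}$, $g_{ij}=g(\partial_i,\partial_j)$ and $[g^{ij}]=[g_{ij}]^{-1}$. $\mathcal M$ is called e-autoparallel if $\nabla^{(\rm e)}_XY$ is a vector field on $\mathcal M$ for all vector fields $X,Y$ on $\mathcal M$; in that case the m-connection $\nabla^{(\rm m)}_{\mathcal M}$ of $\mathcal M$ is the dual with respect to $g|_{\mathcal M}$ of the connection induced by $\nabla^{(\rm e)}$ on $\mathcal M$, and $\xi$ is called m-affine if $\partial_1,\dots,\partial_n$ are parallel with respect to $\nabla^{(\rm m)}_{\mathcal M}$. Then the following conditions are equivalent. (i) $\mathcal M$ is e-autoparallel in $\mathcal S$, and $\xi$ is m-affine. (ii) There exist $F^1,\dots,F^n\in\mathcal L_{\rm h}$ such that, for every $i$, $\sum_j g^{ij}L_j=F^i-\langle F^i\rangle I$ on $\mathcal M$. (iii)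 There exist $F^1,\dots,F^n\in\mathcal L_{\rm h}$ such that, for every $i$, $\sum_j g^{ij}L_j=F^i-\xi^i I$ on $\mathcal M$. (iv) There exist $F^1,\dots,F^n\in\mathcal L_{\rm h}$ such that, for every $i$ and every $\rho\in\mathcal M$, $L_{i,\rho}\in\mathrm{span}\{F^1,\dots,F^n\}+\mathbb R I$ and $\xi^i(\rho)=\langle F^i\rangle_\rho$. Moreover, any $F^1,\dots,F^n$ as in (iii) satisfy $\xi^i=\langle F^i\rangle$ on $\mathcal M$ for every $i$, and for any $F^1,\dots,F^n$ as in (iv) the sum $\mathrm{span}\{F^1,\dots,F^n\}+\mathbb R I$ is direct. -/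

import Mathlib

open scoped ContDiff

namespace QuantumModel

variable {H : Type*} [NormedAddCommGroup H] [InnerProductSpace ℂ H] [CompleteSpace H]

/-- The real normed space of Hermitian operators on the Hilbert space `H`. -/
noncomputable def Herm (H : Type*) [NormedAddCommGroup H] [InnerProductSpace ℂ H]
    [CompleteSpace H] : Type _ :=
  ↥(selfAdjoint (H →L[ℂ] H))

noncomputable instance : NormedAddCommGroup (Herm H) :=
  inferInstanceAs (NormedAddCommGroup (selfAdjoint (H →L[ℂ] H)))

noncomputable instance : NormedSpace ℝ (Herm H) :=
  inferInstanceAs (NormedSpace ℝ (selfAdjoint (H →L[ℂ] H)))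

noncomputable instance : One (Herm H) :=
  inferInstanceAs (One (selfAdjoint (H →L[ℂ] H)))

/-- The operator underlying an element of `Herm H`. -/
def Herm.op (A : Herm H) : H →L[ℂ] H := Subtype.val A

theorem Herm.op_injective : Function.Injective (Herm.op (H := H)) := Subtype.val_injective

theorem Herm.isSelfAdjoint (A : Herm H) : IsSelfAdjoint A.op := Subtype.property A

@[simp] theorem Herm.op_add (A B : Herm H) : (A + B).op = A.op + B.op := rfl

@[simp] theorem Herm.op_smul (c : ℝ) (A : Herm H) : (c • A).op = c • A.op := rfl

@[simp] theorem Herm.op_one : (1 : Herm H).op = 1 := rfl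

instance [FiniteDimensional ℂ H] : FiniteDimensional ℝ (Herm H) := by
  have : FiniteDimensional ℝ (H →L[ℂ] H) := FiniteDimensional.complexToReal (H →L[ℂ] H)
  exact FiniteDimensional.of_injective
    ({ toFun := Herm.op
       map_add' := Herm.op_add
       map_smul' := Herm.op_smul } : Herm H →ₗ[ℝ] (H →L[ℂ] H)) Herm.op_injective

/-- `Tr A`, a real number because `A` is Hermitian. -/
noncomputable def tr (A : Herm H) : ℝ :=
  (LinearMap.trace ℂ H (A.op : H →ₗ[ℂ] H)).re

/-- `Tr (A B)`, a real number because `A` and `B` are Hermitian (the Hilbert-Schmidt inner product).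
For a state `ρ`, the expectation `⟨A⟩_ρ` is `trMul ρ A`. -/
noncomputable def trMul (A B : Herm H) : ℝ :=
  (LinearMap.trace ℂ H ((A.op * B.op : H →L[ℂ] H) : H →ₗ[ℂ] H)).re

/-- The set `S(H)` of strictly positive density operators. It is open in the affine space of
Hermitian operators of trace one, so that the tangent space at each of its points is
identified with the space of Hermitian operators of trace zero. -/
def States (H : Type*) [NormedAddCommGroup H] [InnerProductSpace ℂ H] [CompleteSpace H] :
    Set (Herm H) :=
  {ρ | (∀ x : H, x ≠ 0 → 0 < (inner ℂ (ρ.op x) x).re) ∧ tr ρ = 1}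

/-- A smooth family of inner products `⟨·,·⟩_ρ`, `ρ ∈ S(H)`, on the real linear space of
Hermitian operators, with `⟨A, I⟩_ρ = ⟨A⟩_ρ`. -/
structure InnerFamily (H : Type*) [NormedAddCommGroup H] [InnerProductSpace ℂ H]
    [CompleteSpace H] where
  form : Herm H → Herm H →ₗ[ℝ] Herm H →ₗ[ℝ] ℝ
  symm : ∀ ρ ∈ States H, ∀ A B, form ρ A B = form ρ B A
  pos : ∀ ρ ∈ States H, ∀ A, A ≠ 0 → 0 < form ρ A A
  smooth : ∀ A B, ContDiffOn ℝ ∞ (fun ρ => form ρ A B) (States H)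
  one_right : ∀ ρ ∈ States H, ∀ A, form ρ A 1 = trMul ρ A

/-- A smooth vector field on `S(H)`, written as a map into the Hermitian operators of trace zero. -/
structure IsVectorField (X : Herm H → Herm H) : Prop where
  smooth : ContDiffOn ℝ ∞ X (States H)
  tr_eq_zero : ∀ ρ ∈ States H, tr (X ρ) = 0

namespace InnerFamily

variable (S : InnerFamily H)

/-- The operator `L_u` of a tangent vector `u` at `ρ`: the unique Hermitian operator such that
the derivative `u⟨A⟩ = Tr (u A)` of the expectation of `A` along `u` is `⟨L_u, A⟩_ρ`
for every Hermitian `A`. -/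
noncomputable def logDeriv (ρ u : Herm H) : Herm H :=
  Classical.epsilon fun L => ∀ A, trMul u A = S.form ρ L A

/-- The Riemannian metric `g_ρ(u, v) = ⟨L_u, L_v⟩_ρ`. -/
noncomputable def metric (ρ u v : Herm H) : ℝ :=
  S.form ρ (S.logDeriv ρ u) (S.logDeriv ρ v)

end InnerFamily

theorem tr_add_smul (ρ u : Herm H) (c : ℝ) : tr (ρ + c • u) = tr ρ + c * tr u := by
  simp [tr]

/-- `Tr (A B)` as a bilinear form. -/
noncomputable def trMulLin : Herm H →ₗ[ℝ] Herm H →ₗ[ℝ] ℝ :=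
  LinearMap.mk₂ ℝ trMul
    (by intro a b c; simp [trMul, add_mul])
    (by intro r a b; simp [trMul])
    (by intro a b c; simp [trMul, mul_add])
    (by intro r a b; simp [trMul])

@[simp] theorem trMulLin_apply (A B : Herm H) : trMulLin A B = trMul A B := rfl

theorem trMul_one (A : Herm H) : trMul A 1 = tr A := by simp [trMul, tr]

theorem trMul_self_eq_zero [FiniteDimensional ℂ H] {A : Herm H} (h : trMul A A = 0) : A = 0 := by
  have b := stdOrthonormalBasis ℂ H
  have hs : trMul A A = ∑ i, ‖A.op (b i)‖ ^ 2 := by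
    unfold trMul
    rw [LinearMap.trace_eq_sum_inner _ b, Complex.re_sum]
    refine Finset.sum_congr rfl fun i _ => ?_
    have hA : (A.op : H →ₗ[ℂ] H).IsSymmetric :=
      ContinuousLinearMap.isSelfAdjoint_iff_isSymmetric.1 A.isSelfAdjoint
    have := hA (b i) (A.op (b i))
    simp only [ContinuousLinearMap.coe_coe] at this
    simp only [ContinuousLinearMap.coe_coe, mul_apply_eq_comp]
    rw [← this]
    simpa using inner_self_eq_norm_sq (𝕜 := ℂ) (A.op (b i))
  rw [hs, Finset.sum_eq_zero_iff_of_nonneg (fun i _ => by positivity)] at h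
  apply Herm.op_injective
  apply ContinuousLinearMap.coe_injective
  refine b.toBasis.ext fun i => ?_
  have := h i (Finset.mem_univ i)
  have h2 : A.op (b i) = 0 := by simpa using this
  have h3 : (0 : Herm H).op = 0 := rfl
  simp [h2, h3]

/-- `S(H)` is open in the affine space of Hermitian operators of trace one. -/
theorem eventually_mem_states [FiniteDimensional ℂ H] {ρ u : Herm H} (hρ : ρ ∈ States H)
    (hu : tr u = 0) : ∀ᶠ t : ℝ in nhds 0, ρ + t • u ∈ States H := by
  have hK : IsCompact (Metric.sphere (0 : H) 1) := by
    have : ProperSpace H := FiniteDimensional.proper ℂ H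
    exact isCompact_sphere _ _
  have hcont : Continuous fun z : ℝ × H => (inner ℂ ((ρ + z.1 • u).op z.2) z.2).re := by
    simp only [Herm.op_add, Herm.op_smul, add_apply, smul_apply]
    fun_prop
  have hev : ∀ᶠ t : ℝ in nhds 0, ∀ x ∈ Metric.sphere (0 : H) 1,
      0 < (inner ℂ ((ρ + t • u).op x) x).re := by
    refine hK.eventually_forall_of_forall_eventually fun x hx => ?_
    have h0 : 0 < (inner ℂ ((ρ + (0 : ℝ) • u).op x) x).re := by
      simpa using hρ.1 x (by rintro rfl; simp at hx)
    exact (hcont.tendsto ((0 : ℝ), x)).eventually_const_lt h0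
  filter_upwards [hev] with t ht
  refine ⟨fun x hx => ?_, by rw [tr_add_smul, hu, hρ.2]; simp⟩
  have hn : ‖x‖ ≠ 0 := norm_ne_zero_iff.2 hx
  have := ht (((‖x‖⁻¹ : ℝ) : ℂ) • x) (by simp [norm_smul, hn])
  rw [map_smul, inner_smul_left, inner_smul_right, Complex.conj_ofReal, Complex.re_ofReal_mul,
    Complex.re_ofReal_mul] at this
  have hp : 0 < ‖x‖⁻¹ := by positivity
  exact (mul_pos_iff_of_pos_left hp).1 ((mul_pos_iff_of_pos_left hp).1 this)

theorem contDiffAt_line [FiniteDimensional ℂ H] {F : Type*} [NormedAddCommGroup F]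
    [NormedSpace ℝ F] {f : Herm H → F} (hf : ContDiffOn ℝ ∞ f (States H)) {ρ u : Herm H}
    (hρ : ρ ∈ States H) (hu : tr u = 0) :
    ContDiffAt ℝ ∞ (fun t : ℝ => f (ρ + t • u)) 0 := by
  have h : ContDiffOn ℝ ∞ (fun t : ℝ => f (ρ + t • u)) {t : ℝ | ρ + t • u ∈ States H} :=
    hf.comp (g := f) (f := fun t : ℝ => ρ + t • u) (by fun_prop) (fun t ht => ht)
  exact h.contDiffAt (eventually_mem_states hρ hu)

namespace InnerFamily

variable (S : InnerFamily H)

theorem form_bijective [FiniteDimensional ℂ H] {ρ : Herm H} (hρ : ρ ∈ States H) :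
    Function.Bijective (S.form ρ) := by
  have hinj : Function.Injective (S.form ρ) := by
    rw [← LinearMap.ker_eq_bot, LinearMap.ker_eq_bot']
    intro A hA
    by_contra h
    have := S.pos ρ hρ A h
    simp [hA] at this
  exact ⟨hinj, (LinearMap.injective_iff_surjective_of_finrank_eq_finrank
      (Subspace.dual_finrank_eq (K := ℝ) (V := Herm H)).symm).1 hinj⟩

theorem existsUnique_logDeriv [FiniteDimensional ℂ H] {ρ : Herm H} (hρ : ρ ∈ States H)
    (u : Herm H) : ∃! L, ∀ A, trMul u A = S.form ρ L A := by
  obtain ⟨L, hL⟩ := (S.form_bijective hρ).2 (trMulLin u)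
  refine ⟨L, fun A => by rw [hL]; rfl, fun L' h' => (S.form_bijective hρ).1 ?_⟩
  ext A
  rw [hL, ← h' A]; rfl

theorem logDeriv_spec [FiniteDimensional ℂ H] {ρ : Herm H} (hρ : ρ ∈ States H) (u A : Herm H) :
    trMul u A = S.form ρ (S.logDeriv ρ u) A :=
  Classical.epsilon_spec (p := fun L => ∀ A, trMul u A = S.form ρ L A)
    (S.existsUnique_logDeriv hρ u).exists A

theorem eq_logDeriv [FiniteDimensional ℂ H] {ρ : Herm H} (hρ : ρ ∈ States H) {u L : Herm H}
    (h : ∀ A, trMul u A = S.form ρ L A) : S.logDeriv ρ u = L :=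
  (S.existsUnique_logDeriv hρ u).unique (S.logDeriv_spec hρ u) h

theorem metric_eq [FiniteDimensional ℂ H] {ρ : Herm H} (hρ : ρ ∈ States H) (u v : Herm H) :
    S.metric ρ u v = trMul v (S.logDeriv ρ u) := by
  rw [S.logDeriv_spec hρ v, metric, S.symm ρ hρ]

/-- Every Hermitian operator of expectation zero at `ρ` is `L_W` for a tangent vector `W` at `ρ`. -/
theorem exists_logDeriv_eq [FiniteDimensional ℂ H] {ρ : Herm H} (hρ : ρ ∈ States H) {C : Herm H}
    (hC : trMul ρ C = 0) : ∃ W, tr W = 0 ∧ S.logDeriv ρ W = C := by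
  have hinj : Function.Injective (trMulLin (H := H)) := by
    rw [← LinearMap.ker_eq_bot, LinearMap.ker_eq_bot']
    intro A hA
    apply trMul_self_eq_zero
    rw [← trMulLin_apply, hA]; rfl
  have hsurj : Function.Surjective (trMulLin (H := H)) :=
    (LinearMap.injective_iff_surjective_of_finrank_eq_finrank
      (Subspace.dual_finrank_eq (K := ℝ) (V := Herm H)).symm).1 hinj
  obtain ⟨W, hW⟩ := hsurj (S.form ρ C)
  have h : ∀ A, trMul W A = S.form ρ C A := fun A => by rw [← hW]; rfl
  exact ⟨W, by rw [← trMul_one, h, S.one_right ρ hρ, hC], S.eq_logDeriv hρ h⟩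

/-- Along a line in `S(H)`, `L_Y` is differentiable if `Y` is. -/
theorem differentiableAt_logDeriv [FiniteDimensional ℂ H] {ρ u : Herm H} (hρ : ρ ∈ States H)
    (hu : tr u = 0) {y : ℝ → Herm H} (hy : DifferentiableAt ℝ y 0) :
    DifferentiableAt ℝ (fun t : ℝ => S.logDeriv (ρ + t • u) (y t)) 0 := by
  let e : (Herm H →ₗ[ℝ] ℝ) ≃ₗ[ℝ] (Herm H →L[ℝ] ℝ) := LinearMap.toContinuousLinearMap
  let B : ℝ → Herm H →L[ℝ] (Herm H →L[ℝ] ℝ) := fun t =>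
    LinearMap.toContinuousLinearMap (e.toLinearMap ∘ₗ S.form (ρ + t • u))
  let T : Herm H →L[ℝ] (Herm H →L[ℝ] ℝ) :=
    LinearMap.toContinuousLinearMap (e.toLinearMap ∘ₗ trMulLin)
  have hB : ContDiffAt ℝ 1 B 0 := by
    have h1 : ∀ A C, ContDiffAt ℝ ∞ (fun t => B t A C) 0 := fun A C =>
      contDiffAt_line (S.smooth A C) hρ hu
    have h2 : ∀ A C, ∀ᶠ t in nhds 0, ContDiffAt ℝ 1 (fun t => B t A C) t := fun A C =>
      ((h1 A C).of_le (by exact_mod_cast le_top)).eventually (by simp)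
    let hb := Module.finBasis ℝ (Herm H)
    have h3 : {t | ∀ i j, ContDiffAt ℝ 1 (fun t => B t (hb i) (hb j)) t} ∈ nhds (0 : ℝ) := by
      simp only [Filter.eventually_all, ← Filter.eventually_iff]
      exact fun i j => h2 _ _
    have h4 : ContDiffOn ℝ 1 B {t | ∀ i j, ContDiffAt ℝ 1 (fun t => B t (hb i) (hb j)) t} := by
      rw [contDiffOn_clm_apply]; intro A
      rw [contDiffOn_clm_apply]; intro C
      have : (fun t => B t A C) =
          fun t => ∑ i, ∑ j, hb.repr A i * (hb.repr C j * B t (hb i) (hb j)) := by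
        funext t
        conv_lhs => rw [← hb.sum_repr A, ← hb.sum_repr C]
        simp only [map_sum, map_smul, sum_apply, smul_apply, smul_eq_mul, Finset.mul_sum]
        rw [Finset.sum_comm]
        exact Finset.sum_congr rfl fun i _ => Finset.sum_congr rfl fun j _ => by ring
      rw [this]
      refine ContDiffOn.sum fun i _ => ContDiffOn.sum fun j _ => ?_
      exact contDiffOn_const.mul (contDiffOn_const.mul fun t ht => (ht i j).contDiffWithinAt)
    exact h4.contDiffAt h3
  have hinv : ∀ σ ∈ States H, ∃ E : Herm H ≃L[ℝ] (Herm H →L[ℝ] ℝ), ∀ A C, E A C = S.form σ A C := by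
    intro σ hσ
    exact ⟨((LinearEquiv.ofBijective _ (S.form_bijective hσ)).trans e).toContinuousLinearEquiv,
      fun A C => rfl⟩
  have hD : DifferentiableAt ℝ (fun t => (B t).inverse (T (y t))) 0 := by
    obtain ⟨E, hE⟩ := hinv ρ hρ
    have hE0 : (E : Herm H →L[ℝ] (Herm H →L[ℝ] ℝ)) = B 0 := by
      ext A C; simp [B, e, hE]
    have h1 : ContDiffAt ℝ 1 ContinuousLinearMap.inverse (B 0) := by
      rw [← hE0]
      exact contDiffAt_map_inverse E
    have h2 := (h1.comp (0 : ℝ) hB).differentiableAt one_ne_zero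
    exact h2.clm_apply (T.differentiableAt.comp (0 : ℝ) hy)
  refine hD.congr_of_eventuallyEq ?_
  filter_upwards [eventually_mem_states hρ hu] with t ht
  obtain ⟨E, hE⟩ := hinv _ ht
  have hEt : (E : Herm H →L[ℝ] (Herm H →L[ℝ] ℝ)) = B t := by
    ext A C; simp [B, e, hE]
  rw [← hEt, ContinuousLinearMap.inverse_equiv]
  refine S.eq_logDeriv ht fun A => ?_
  rw [← hE]
  simp [T, e]

end InnerFamily

/-- The m-connection `∇⁽ᵐ⁾_X Y` on `S(H)`: the derivative of `Y` along `X` in the affine space of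
Hermitian operators of trace one. -/
noncomputable def mConnection (X Y : Herm H → Herm H) (ρ : Herm H) : Herm H :=
  lineDeriv ℝ Y ρ (X ρ)

namespace InnerFamily

variable (S : InnerFamily H)

/-- `W` is the value at `ρ` of the covariant derivative of `Y` along `X` for the connection dual to
the m-connection with respect to the metric:
`X g(Y, Z) = g(W, Z) + g(Y, ∇⁽ᵐ⁾_X Z)` at `ρ` for every smooth vector field `Z`. -/
def IsEValue (X Y : Herm H → Herm H) (ρ W : Herm H) : Prop :=
  tr W = 0 ∧ ∀ Z : Herm H → Herm H, IsVectorField Z →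
    lineDeriv ℝ (fun σ => S.metric σ (Y σ) (Z σ)) ρ (X ρ) =
      S.metric ρ W (Z ρ) + S.metric ρ (Y ρ) (mConnection X Z ρ)

theorem hasDerivAt_trMul [FiniteDimensional ℂ H] {y z : ℝ → Herm H} {y' z' : Herm H} {t : ℝ}
    (hy : HasDerivAt y y' t) (hz : HasDerivAt z z' t) :
    HasDerivAt (fun t => trMul (y t) (z t)) (trMul y' (z t) + trMul (y t) z') t := by
  let T : Herm H →L[ℝ] (Herm H →L[ℝ] ℝ) := LinearMap.toContinuousLinearMap
    ((LinearMap.toContinuousLinearMap : (Herm H →ₗ[ℝ] ℝ) ≃ₗ[ℝ] (Herm H →L[ℝ] ℝ)).toLinearMap ∘ₗ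
      trMulLin)
  have h1 : HasDerivAt (fun t => T (y t)) (T y') t := T.hasFDerivAt.comp_hasDerivAt t hy
  exact h1.clm_apply hz

theorem lineDifferentiableAt_of_isVectorField [FiniteDimensional ℂ H] {Y : Herm H → Herm H}
    (hY : IsVectorField Y) {ρ u : Herm H} (hρ : ρ ∈ States H) (hu : tr u = 0) :
    LineDifferentiableAt ℝ Y ρ u :=
  (contDiffAt_line hY.smooth hρ hu).differentiableAt (by simp)

theorem metric_eq' [FiniteDimensional ℂ H] {ρ : Herm H} (hρ : ρ ∈ States H) (u v : Herm H) :
    S.metric ρ u v = trMul u (S.logDeriv ρ v) := by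
  rw [S.logDeriv_spec hρ u, metric]

theorem exists_isEValue [FiniteDimensional ℂ H] {X Y : Herm H → Herm H} {ρ : Herm H}
    (hρ : ρ ∈ States H) (hX : tr (X ρ) = 0) (hY : LineDifferentiableAt ℝ Y ρ (X ρ)) :
    ∃ W, S.IsEValue X Y ρ W := by
  have hD := (S.differentiableAt_logDeriv hρ hX hY).hasDerivAt
  set D := deriv (fun t : ℝ => S.logDeriv (ρ + t • X ρ) (Y (ρ + t • X ρ))) 0
  obtain ⟨W, hW0, hW⟩ := S.exists_logDeriv_eq hρ (C := D - trMul ρ D • (1 : Herm H)) (by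
    rw [← trMulLin_apply, map_sub, map_smul, trMulLin_apply, trMulLin_apply, trMul_one, hρ.2]
    simp)
  refine ⟨W, hW0, fun Z hZ => ?_⟩
  have hZ' := (lineDifferentiableAt_of_isVectorField hZ hρ hX).hasDerivAt
  have h := hasDerivAt_trMul hZ' hD
  simp only [zero_smul, add_zero] at h
  rw [S.metric_eq hρ, S.metric_eq hρ, hW, ← trMulLin_apply (Z ρ) (D - _), map_sub, map_smul,
    trMulLin_apply, trMulLin_apply, trMul_one, hZ.tr_eq_zero ρ hρ, smul_zero, sub_zero, add_comm]
  refine (h.congr_of_eventuallyEq ?_).deriv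
  filter_upwards [eventually_mem_states hρ hX] with t ht
  exact S.metric_eq ht _ _

theorem IsEValue.unique [FiniteDimensional ℂ H] {X Y : Herm H → Herm H} {ρ W W' : Herm H}
    (hρ : ρ ∈ States H) (h : S.IsEValue X Y ρ W) (h' : S.IsEValue X Y ρ W') : W = W' := by
  have hsub : tr (W - W') = 0 := by
    have := tr_add_smul W W' (-1)
    rw [h.1, h'.1] at this
    simpa [sub_eq_add_neg] using this
  have hc : IsVectorField (fun _ : Herm H => W - W') := ⟨contDiffOn_const, fun _ _ => hsub⟩
  have h1 := h.2 _ hc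
  rw [h'.2 _ hc, add_left_inj, S.metric_eq' hρ, S.metric_eq' hρ, ← sub_eq_zero] at h1
  have h2 : trMul (W - W') (S.logDeriv ρ (W - W')) = 0 := by
    rw [← trMulLin_apply, map_sub, LinearMap.sub_apply, trMulLin_apply, trMulLin_apply]
    linarith
  rw [S.logDeriv_spec hρ] at h2
  have h3 : S.logDeriv ρ (W - W') = 0 := by
    by_contra hne
    exact (S.pos ρ hρ _ hne).ne' h2
  have h4 := S.logDeriv_spec hρ (W - W') (W - W')
  rw [h3, map_zero] at h4
  exact sub_eq_zero.1 (trMul_self_eq_zero h4)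

/-- The e-connection `∇⁽ᵉ⁾_X Y` on `S(H)`, the dual connection of the m-connection. -/
noncomputable def eConnection (X Y : Herm H → Herm H) (ρ : Herm H) : Herm H :=
  Classical.epsilon (S.IsEValue X Y ρ)

/-- The e-connection satisfies the duality that defines it. -/
theorem eConnection_spec [FiniteDimensional ℂ H] {X Y : Herm H → Herm H} {ρ : Herm H}
    (hρ : ρ ∈ States H) (hX : tr (X ρ) = 0) (hY : LineDifferentiableAt ℝ Y ρ (X ρ)) :
    S.IsEValue X Y ρ (S.eConnection X Y ρ) :=
  Classical.epsilon_spec (S.exists_isEValue hρ hX hY)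

theorem eConnection_dual [FiniteDimensional ℂ H] {X Y Z : Herm H → Herm H} (hX : IsVectorField X)
    (hY : IsVectorField Y) (hZ : IsVectorField Z) {ρ : Herm H} (hρ : ρ ∈ States H) :
    lineDeriv ℝ (fun σ => S.metric σ (Y σ) (Z σ)) ρ (X ρ) =
      S.metric ρ (S.eConnection X Y ρ) (Z ρ) + S.metric ρ (Y ρ) (mConnection X Z ρ) :=
  (S.eConnection_spec hρ (hX.tr_eq_zero ρ hρ)
    (lineDifferentiableAt_of_isVectorField hY hρ (hX.tr_eq_zero ρ hρ))).2 Z hZ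

/-- The connection coefficients of the e-connection in the affine structure of `S(H)`:
`∇⁽ᵉ⁾_U V` at `ρ` for the constant vector fields `U = u` and `V = v`. -/
noncomputable def eCoeff (ρ u v : Herm H) : Herm H :=
  S.eConnection (fun _ => u) (fun _ => v) ρ

/-- In the affine structure of `S(H)`, the e-connection is the derivative plus the coefficient term. -/
theorem eConnection_eq [FiniteDimensional ℂ H] {X Y : Herm H → Herm H} (hX : IsVectorField X)
    (hY : IsVectorField Y) {ρ : Herm H} (hρ : ρ ∈ States H) :
    S.eConnection X Y ρ = lineDeriv ℝ Y ρ (X ρ) + S.eCoeff ρ (X ρ) (Y ρ) := by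
  have hx := hX.tr_eq_zero ρ hρ
  have hy := lineDifferentiableAt_of_isVectorField hY hρ hx
  have hc := S.eConnection_spec (X := fun _ => X ρ) (Y := fun _ => Y ρ) hρ hx
    (differentiableAt_const _)
  refine IsEValue.unique S hρ (S.eConnection_spec hρ hx hy) ⟨?_, fun Z hZ => ?_⟩
  · have h1 := tr_add_smul (lineDeriv ℝ Y ρ (X ρ)) (S.eCoeff ρ (X ρ) (Y ρ)) 1
    rw [one_smul, eCoeff, hc.1, mul_zero, add_zero] at h1
    rw [eCoeff, h1]
    let f : Herm H →ₗ[ℝ] ℝ := trMulLin.flip 1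
    have hf : ∀ A, LinearMap.toContinuousLinearMap f A = tr A := fun A => trMul_one A
    have h2 := (LinearMap.toContinuousLinearMap f).hasFDerivAt.comp_hasDerivAt (0 : ℝ) hy.hasDerivAt
    have h3 : HasDerivAt (fun _ : ℝ => (0 : ℝ))
        (LinearMap.toContinuousLinearMap f (deriv (fun t : ℝ => Y (ρ + t • X ρ)) 0)) 0 := by
      refine h2.congr_of_eventuallyEq ?_
      filter_upwards [eventually_mem_states hρ hx] with t ht
      exact ((hf _).trans (hY.tr_eq_zero _ ht)).symm
    rw [hf] at h3
    exact h3.unique (hasDerivAt_const _ _)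
  · have hz := lineDifferentiableAt_of_isVectorField hZ hρ hx
    have hL := (S.differentiableAt_logDeriv hρ hx hz).hasDerivAt
    have h1 := hasDerivAt_trMul hy.hasDerivAt hL
    have h2 := hasDerivAt_trMul (hasDerivAt_const (0 : ℝ) (Y ρ)) hL
    have e1 : lineDeriv ℝ (fun σ => S.metric σ (Y σ) (Z σ)) ρ (X ρ) = _ :=
      (h1.congr_of_eventuallyEq (by
        filter_upwards [eventually_mem_states hρ hx] with t ht
        exact S.metric_eq' ht _ _)).deriv
    have e2 : lineDeriv ℝ (fun σ => S.metric σ (Y ρ) (Z σ)) ρ (X ρ) = _ :=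
      (h2.congr_of_eventuallyEq (by
        filter_upwards [eventually_mem_states hρ hx] with t ht
        exact S.metric_eq' ht _ _)).deriv
    have e3 := hc.2 Z hZ
    rw [e2] at e3
    have e5 : ∀ A B C : Herm H, trMul (A + B) C = trMul A C + trMul B C := fun A B C => by
      simp only [← trMulLin_apply, map_add, LinearMap.add_apply]
    rw [e1, S.metric_eq' hρ (_ + _), e5]
    rw [S.metric_eq' hρ (S.eConnection _ _ ρ)] at e3
    simp only [zero_smul, add_zero] at e3 ⊢
    have e4 : trMul (0 : Herm H) (S.logDeriv ρ (Z ρ)) = 0 := by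
      rw [← trMulLin_apply, map_zero]; rfl
    rw [e4, zero_add] at e3
    rw [e3, eCoeff, add_assoc]
    rfl

end InnerFamily

/-- An `n`-dimensional model `(M, ξ)`: a connected submanifold `M` of `S(H)` with a global coordinate
system `ξ`, given by the inverse `ξ ↦ ρ_ξ` of the chart, which is an injective immersion of the
open set `Ξ = ξ(M)` of `ℝⁿ`. As a set, `M` is the image of `Ξ`; functions and fields on `M` are
written as functions of the coordinates `x ∈ Ξ`, and the coordinates of `ρ_x` are `x`. -/
structure Model (H : Type*) [NormedAddCommGroup H] [InnerProductSpace ℂ H] [CompleteSpace H]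
    (n : ℕ) where
  dom : Set (Fin n → ℝ)
  param : (Fin n → ℝ) → Herm H
  isOpen_dom : IsOpen dom
  isConnected_dom : IsConnected dom
  smooth : ContDiffOn ℝ ∞ param dom
  mem_states : ∀ x ∈ dom, param x ∈ States H
  injOn : Set.InjOn param dom
  immersion : ∀ x ∈ dom, Function.Injective (fderiv ℝ param x)

namespace Model

variable {n : ℕ} (M : Model H n)

/-- A smooth vector field `∑ X^i ∂_i` on `M`, given by its components. -/
def IsField (X : (Fin n → ℝ) → (Fin n → ℝ)) : Prop := ContDiffOn ℝ ∞ X M.dom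

/-- The tangent vectors `X_ρ = ∑ X^i ∂_i ρ_ξ` of `S(H)` that make up the vector field `X` on `M`. -/
noncomputable def push (X : (Fin n → ℝ) → (Fin n → ℝ)) (x : Fin n → ℝ) : Herm H :=
  fderiv ℝ M.param x (X x)

/-- The coordinate vector field `∂_i`, as a vector field on `M`. -/
def coordField (i : Fin n) : (Fin n → ℝ) → (Fin n → ℝ) := fun _ => Pi.single i 1

/-- `L_i = L_{∂_i}`. -/
noncomputable def L (S : InnerFamily H) (i : Fin n) (x : Fin n → ℝ) : Herm H :=
  S.logDeriv (M.param x) (M.push (coordField i) x)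

/-- The matrix `g_{ij} = g(∂_i, ∂_j)`. -/
noncomputable def gram (S : InnerFamily H) (x : Fin n → ℝ) : Matrix (Fin n) (Fin n) ℝ :=
  Matrix.of fun i j =>
    S.metric (M.param x) (M.push (coordField i) x) (M.push (coordField j) x)

/-- The derivative `∇⁽ᵉ⁾_X Y` induced by the e-connection of `S(H)`, where `X` is a vector field on `M`
and `Y` assigns to each point of `M` a tangent vector of `S(H)`: expanding `Y` in a frame of
constant vector fields, it is the derivative of the components plus the coefficient term. -/
noncomputable def eDeriv (S : InnerFamily H) (X : (Fin n → ℝ) → (Fin n → ℝ))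
    (Y : (Fin n → ℝ) → Herm H) (x : Fin n → ℝ) : Herm H :=
  fderiv ℝ Y x (X x) + S.eCoeff (M.param x) (M.push X x) (Y x)

/-- `M` is e-autoparallel in `S(H)`: `∇⁽ᵉ⁾_X Y` is a vector field on `M` for all vector fields
`X`, `Y` on `M`. -/
def IsEAutoparallel (S : InnerFamily H) : Prop :=
  ∀ X Y, M.IsField X → M.IsField Y →
    ∃ Z, M.IsField Z ∧ ∀ x ∈ M.dom, M.eDeriv S X (M.push Y) x = M.push Z x

/-- `W` is `∇_X Z` for the m-connection `∇` of an e-autoparallel `M`, which is the dual of the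
connection that the e-connection induces on `M`:
`X g(Y, Z) = g(∇⁽ᵉ⁾_X Y, Z) + g(Y, W)` for every vector field `Y` on `M`. -/
def IsMDeriv (S : InnerFamily H) (X Z W : (Fin n → ℝ) → (Fin n → ℝ)) : Prop :=
  M.IsField W ∧ ∀ Y, M.IsField Y → ∀ x ∈ M.dom,
    fderiv ℝ (fun y => S.metric (M.param y) (M.push Y y) (M.push Z y)) x (X x) =
      S.metric (M.param x) (M.eDeriv S X (M.push Y) x) (M.push Z x) +
        S.metric (M.param x) (M.push Y x) (M.push W x)

/-- The coordinate system of `M` is m-affine: every `∂_j` is parallel for the m-connection on `M`. -/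
def IsMAffine (S : InnerFamily H) : Prop :=
  ∀ j X, M.IsField X → M.IsMDeriv S X (coordField j) 0

end Model

end QuantumModel

/-! The map `u ↦ L_u` turns the e-connection into plain differentiation modulo the identity. Testing
duality on m-parallel (constant) fields `Z` shows that `L` of `∇⁽ᵉ⁾_X Y` differs from the derivative
of `L_Y` along `X` by a multiple of `I`. The multiple carries no information, because `⟨L_u⟩ = Tr u
= 0` for every tangent vector. These facts are `InnerFamily.exists_logDeriv_eCoeff` and, on a model,
`exists_logDeriv_eDeriv`.

Put `E^i = ∑ g^{ij} L_j`, the operator `L` of the gradient of `ξ^i`; the gradients are the frame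
dual to `∂_1, …, ∂_n`. (i) ⇒ (ii): since the `∂_j` are m-parallel, the dual frame is e-parallel, so
each `E^i` is constant modulo `I` on the connected `M`; expectation zero then forces the form `F^i -
⟨F^i⟩ I`. (ii) ⇒ (iii): pairing a tangent vector with `E^i` gives `d⟨F^i⟩ = dξ^i`, so `⟨F^i⟩ - ξ^i`
is a constant that can be absorbed into `F^i`. (iii) ⇒ (i): `L_Y = ∑ Y_i (F^i - ξ^i I)` with `Y_i =
g(Y, ∂_i)`. Modulo `I` only the `Y_i` get differentiated, so `∇⁽ᵉ⁾_X Y` is tangent to `M` with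
covariant components `X Y_i`, which is also the duality for m-parallel `∂_i`. (iii) ⇔ (iv): lowering
the index puts `L_i` in the span. Conversely, pairing with `∂_k` annihilates `I` and reads off the
coefficient of `F^k`, which also makes the sum direct. -/

namespace QuantumModel

variable {H : Type*} [NormedAddCommGroup H] [InnerProductSpace ℂ H] [CompleteSpace H]

/-! ### Traces and expectations. -/

section Trace

theorem trMul_add_right (A B C : Herm H) : trMul A (B + C) = trMul A B + trMul A C := by
  simp only [← trMulLin_apply, map_add]

theorem trMul_sub_right (A B C : Herm H) : trMul A (B - C) = trMul A B - trMul A C := by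
  simp only [← trMulLin_apply, map_sub]

theorem trMul_smul_right (c : ℝ) (A B : Herm H) : trMul A (c • B) = c * trMul A B := by
  simp only [← trMulLin_apply, map_smul, smul_eq_mul]

theorem trMul_sum_right {ι : Type*} (s : Finset ι) (A : Herm H) (B : ι → Herm H) :
    trMul A (∑ i ∈ s, B i) = ∑ i ∈ s, trMul A (B i) := by
  simp only [← trMulLin_apply, map_sum]

theorem trMul_one_of_mem_states {ρ : Herm H} (hρ : ρ ∈ States H) : trMul ρ 1 = 1 := by
  rw [trMul_one, hρ.2]

/-- Two Hermitian operators with the same expectation that agree modulo the identity are equal. -/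
theorem eq_of_eq_add_smul_one {ρ A B : Herm H} (hρ : ρ ∈ States H) {c : ℝ}
    (h : A = B + c • (1 : Herm H)) (hAB : trMul ρ A = trMul ρ B) : A = B := by
  have h1 := congrArg (trMul ρ) h
  rw [trMul_add_right, trMul_smul_right, trMul_one_of_mem_states hρ, hAB] at h1
  have : c = 0 := by linarith
  simpa [this] using h

variable [FiniteDimensional ℂ H]

/-- `Tr (A B)` as a continuous bilinear form. -/
noncomputable def trMulCLM : Herm H →L[ℝ] Herm H →L[ℝ] ℝ :=
  LinearMap.toContinuousLinearMap
    ((LinearMap.toContinuousLinearMap : (Herm H →ₗ[ℝ] ℝ) ≃ₗ[ℝ] (Herm H →L[ℝ] ℝ)).toLinearMap ∘ₗ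
      trMulLin)

@[simp] theorem trMulCLM_apply (A B : Herm H) : trMulCLM A B = trMul A B := rfl

/-- A Hermitian operator orthogonal to all Hermitian operators of trace zero is a multiple of the
identity. -/
theorem exists_eq_smul_one {A : Herm H} (h : ∀ Z, tr Z = 0 → trMul Z A = 0) :
    ∃ c : ℝ, A = c • (1 : Herm H) := by
  by_cases h1 : tr (1 : Herm H) = 0
  -- Degenerate case `H = 0`, in which the quotient by `tr 1` below is not available.
  · have h2 : (1 : Herm H) = 0 := trMul_self_eq_zero (by rw [trMul_one, h1])
    refine ⟨0, (trMul_self_eq_zero (h A ?_)).trans (zero_smul ℝ _).symm⟩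
    rw [← trMul_one, h2, ← trMulLin_apply, map_zero]
  -- The constant makes `A - c I` traceless. It is then orthogonal to `A` by hypothesis and to `I`
  -- by tracelessness, hence to itself.
  · refine ⟨tr A / tr (1 : Herm H), sub_eq_zero.1 (trMul_self_eq_zero ?_)⟩
    have h0 : tr (A - (tr A / tr (1 : Herm H)) • (1 : Herm H)) = 0 := by
      rw [sub_eq_add_neg, ← neg_smul, tr_add_smul]
      field_simp
      ring
    rw [trMul_sub_right, h _ h0, trMul_smul_right, trMul_one, h0]
    simp

end Trace

/-! ### Smoothness of `u ↦ L_u`, and the e-connection modulo the identity. -/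

namespace InnerFamily

variable [FiniteDimensional ℂ H] (S : InnerFamily H)

/-- The inner product `⟨·,·⟩_σ` as a continuous bilinear form. -/
noncomputable def formCLM (σ : Herm H) : Herm H →L[ℝ] Herm H →L[ℝ] ℝ :=
  LinearMap.toContinuousLinearMap
    ((LinearMap.toContinuousLinearMap : (Herm H →ₗ[ℝ] ℝ) ≃ₗ[ℝ] (Herm H →L[ℝ] ℝ)).toLinearMap ∘ₗ
      S.form σ)

@[simp] theorem formCLM_apply (σ A B : Herm H) : S.formCLM σ A B = S.form σ A B := rfl

theorem contDiffOn_formCLM : ContDiffOn ℝ ∞ S.formCLM (States H) := by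
  rw [contDiffOn_clm_apply]
  intro A
  rw [contDiffOn_clm_apply]
  exact fun B => S.smooth A B

theorem exists_equiv_formCLM {σ : Herm H} (hσ : σ ∈ States H) :
    ∃ E : Herm H ≃L[ℝ] (Herm H →L[ℝ] ℝ), (E : Herm H →L[ℝ] (Herm H →L[ℝ] ℝ)) = S.formCLM σ :=
  ⟨((LinearEquiv.ofBijective _ (S.form_bijective hσ)).trans
    LinearMap.toContinuousLinearMap).toContinuousLinearEquiv, by ext; rfl⟩

/-- The map `u ↦ L_u` at `σ`, as a continuous linear map. -/
noncomputable def logDerivCLM (σ : Herm H) : Herm H →L[ℝ] Herm H :=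
  (S.formCLM σ).inverse ∘L trMulCLM

theorem logDerivCLM_apply {σ : Herm H} (hσ : σ ∈ States H) (u : Herm H) :
    S.logDerivCLM σ u = S.logDeriv σ u := by
  obtain ⟨E, hE⟩ := S.exists_equiv_formCLM hσ
  refine (S.eq_logDeriv hσ fun A => ?_).symm
  rw [← formCLM_apply, logDerivCLM, ← hE, ContinuousLinearMap.inverse_equiv]
  simp

/-- Positive definiteness makes the form invertible at every state, and inversion of continuous
linear maps is smooth at invertible ones. -/
theorem contDiffOn_logDerivCLM : ContDiffOn ℝ ∞ S.logDerivCLM (States H) := by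
  have h : ContDiffOn ℝ ∞ (fun σ => (S.formCLM σ).inverse) (States H) := by
    intro σ hσ
    obtain ⟨E, hE⟩ := S.exists_equiv_formCLM hσ
    have h1 : ContDiffAt ℝ ∞ ContinuousLinearMap.inverse (S.formCLM σ) := by
      rw [← hE]
      exact contDiffAt_map_inverse E
    exact h1.comp_contDiffWithinAt σ (S.contDiffOn_formCLM σ hσ)
  exact h.clm_comp contDiffOn_const

/-- The defining property of `L_u` tested on `A = I`. For `u` of trace zero it gives `⟨L_u⟩ = 0`,
the normalization that later determines every multiple of `I`. -/
theorem trMul_logDeriv {ρ : Herm H} (hρ : ρ ∈ States H) (u : Herm H) :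
    trMul ρ (S.logDeriv ρ u) = tr u := by
  rw [← S.one_right ρ hρ, ← S.logDeriv_spec hρ, trMul_one]

theorem logDeriv_injective {ρ : Herm H} (hρ : ρ ∈ States H) :
    Function.Injective (S.logDeriv ρ) := by
  intro u v h
  have h1 : trMulLin u (u - v) = trMulLin v (u - v) := by
    rw [trMulLin_apply, S.logDeriv_spec hρ, h, ← S.logDeriv_spec hρ, trMulLin_apply]
  refine sub_eq_zero.1 (trMul_self_eq_zero ?_)
  rw [← trMulLin_apply, map_sub trMulLin, LinearMap.sub_apply, h1, sub_self]

theorem eq_zero_of_metric_self {ρ u : Herm H} (hρ : ρ ∈ States H) (h : S.metric ρ u u = 0) :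
    u = 0 := by
  have h0 : S.logDeriv ρ u = 0 := by
    by_contra hne
    exact (S.pos ρ hρ _ hne).ne' h
  refine S.logDeriv_injective hρ ?_
  rw [h0, ← S.logDerivCLM_apply hρ, map_zero]

/-- In terms of the operators `L_u`, the coefficients of the e-connection are, modulo the identity,
the derivatives of `L_v`. -/
theorem exists_logDeriv_eCoeff {ρ u v : Herm H} (hρ : ρ ∈ States H) (hu : tr u = 0)
    {G' : Herm H →L[ℝ] Herm H →L[ℝ] Herm H}
    (hG : HasFDerivWithinAt S.logDerivCLM G' (States H) ρ) :
    ∃ c : ℝ, S.logDeriv ρ (S.eCoeff ρ u v) = G' u v + c • (1 : Herm H) := by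
  have hs := S.eConnection_spec (X := fun _ => u) (Y := fun _ => v) hρ hu
    (differentiableAt_const _)
  -- Duality is tested on constant fields `Z`: their m-derivative vanishes, leaving only the
  -- derivative of `Tr (Z L_v)`. As `Z` ranges over all traceless operators, the difference must be
  -- a multiple of `I`.
  obtain ⟨c, hc⟩ := exists_eq_smul_one (A := S.logDeriv ρ (S.eCoeff ρ u v) - G' u v) fun Z hZ => by
    have h := hs.2 (fun _ => Z) ⟨contDiffOn_const, fun _ _ => hZ⟩
    have hline : HasDerivAt (fun t : ℝ => ρ + t • u) u 0 := by
      simpa using ((hasDerivAt_id (0 : ℝ)).smul_const u).const_add ρ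
    -- Differentiability is only known within the states. A line in a traceless direction stays
    -- there for small `t`, so along it the derivative is unrestricted.
    have h1 : HasDerivAt (fun t : ℝ => S.logDerivCLM (ρ + t • u)) (G' u) 0 := by
      have hG0 : HasFDerivWithinAt S.logDerivCLM G' (States H) (ρ + (0 : ℝ) • u) := by simpa using hG
      have := hG0.comp_hasDerivWithinAt (s := {t : ℝ | ρ + t • u ∈ States H}) (0 : ℝ)
        hline.hasDerivWithinAt (fun t ht => ht)
      exact this.hasDerivAt (eventually_mem_states hρ hu)
    have h2 : HasDerivAt (fun t : ℝ => trMul Z (S.logDerivCLM (ρ + t • u) v)) (trMul Z (G' u v)) 0 :=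
      (trMulCLM Z).hasFDerivAt.comp_hasDerivAt (0 : ℝ)
        (((ContinuousLinearMap.apply ℝ (Herm H) v).hasFDerivAt).comp_hasDerivAt (0 : ℝ) h1)
    have h3 : lineDeriv ℝ (fun σ => S.metric σ v Z) ρ u = trMul Z (G' u v) := by
      refine (h2.congr_of_eventuallyEq ?_).deriv
      filter_upwards [eventually_mem_states hρ hu] with t ht
      rw [S.metric_eq ht, S.logDerivCLM_apply ht]
    have h4 : mConnection (fun _ => u) (fun _ => Z) ρ = 0 := by
      simp [mConnection, lineDeriv]
    have h5 : S.metric ρ v 0 = 0 := by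
      rw [S.metric_eq hρ, ← trMulLin_apply, map_zero]; rfl
    simp only [h3, h4, h5, add_zero, S.metric_eq hρ] at h
    rw [trMul_sub_right, h, eCoeff, sub_self]
  exact ⟨c, by rw [← hc]; abel⟩

theorem tr_eCoeff {ρ u v : Herm H} (hρ : ρ ∈ States H) (hu : tr u = 0) :
    tr (S.eCoeff ρ u v) = 0 :=
  (S.eConnection_spec (X := fun _ => u) (Y := fun _ => v) hρ hu (differentiableAt_const _)).1

end InnerFamily

end QuantumModel

namespace QuantumModel

/-! ### The metric of a model and the frame dual to the coordinate frame. -/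

namespace Model

variable {H : Type*} [NormedAddCommGroup H] [InnerProductSpace ℂ H] [CompleteSpace H]
  {n : ℕ} (M : Model H n)

theorem differentiableAt_param {x : Fin n → ℝ} (hx : x ∈ M.dom) : DifferentiableAt ℝ M.param x :=
  (M.smooth.contDiffAt (M.isOpen_dom.mem_nhds hx)).differentiableAt (by simp)

theorem fderiv_param_apply (x v : Fin n → ℝ) :
    fderiv ℝ M.param x v = ∑ j, v j • M.push (coordField j) x := by
  conv_lhs => rw [pi_eq_sum_univ' v, map_sum]
  refine Finset.sum_congr rfl fun j _ => ?_
  rw [map_smul]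
  congr 2

theorem contDiffOn_fderiv_param : ContDiffOn ℝ ∞ (fderiv ℝ M.param) M.dom :=
  M.smooth.fderiv_of_isOpen M.isOpen_dom (by simp)

theorem contDiffOn_push {Y : (Fin n → ℝ) → Fin n → ℝ} (hY : M.IsField Y) :
    ContDiffOn ℝ ∞ (M.push Y) M.dom :=
  M.contDiffOn_fderiv_param.clm_apply hY

theorem isField_coordField (j : Fin n) : M.IsField (coordField j) := contDiffOn_const

theorem hasFDerivAt_push {Y : (Fin n → ℝ) → Fin n → ℝ} (hY : M.IsField Y) {x : Fin n → ℝ}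
    (hx : x ∈ M.dom) : HasFDerivAt (M.push Y) (fderiv ℝ (M.push Y) x) x :=
  (((M.contDiffOn_push hY).contDiffAt (M.isOpen_dom.mem_nhds hx)).differentiableAt
    (by simp)).hasFDerivAt

variable [FiniteDimensional ℂ H] (S : InnerFamily H)

theorem hasFDerivAt_trMul_param {x : Fin n → ℝ} (hx : x ∈ M.dom) (A : Herm H) :
    HasFDerivAt (fun y => trMul (M.param y) A) (trMulCLM.flip A ∘L fderiv ℝ M.param x) x :=
  (trMulCLM.flip A).hasFDerivAt.comp x (M.differentiableAt_param hx).hasFDerivAt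

theorem tr_fderiv_param {x : Fin n → ℝ} (hx : x ∈ M.dom) (v : Fin n → ℝ) :
    tr (fderiv ℝ M.param x v) = 0 := by
  have h1 := M.hasFDerivAt_trMul_param hx 1
  have h2 : HasFDerivAt (fun y => trMul (M.param y) 1) (0 : (Fin n → ℝ) →L[ℝ] ℝ) x := by
    refine (hasFDerivAt_const (1 : ℝ) x).congr_of_eventuallyEq ?_
    filter_upwards [M.isOpen_dom.mem_nhds hx] with y hy
    exact trMul_one_of_mem_states (M.mem_states y hy)
  have h3 := congrArg (fun f : (Fin n → ℝ) →L[ℝ] ℝ => f v) (h1.unique h2)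
  rw [← trMul_one]
  simpa using h3

/-- The map `v ↦ L_{∂_v}` at the point with coordinates `x`. -/
noncomputable def tangentLog (x : Fin n → ℝ) : (Fin n → ℝ) →L[ℝ] Herm H :=
  S.logDerivCLM (M.param x) ∘L fderiv ℝ M.param x

theorem logDeriv_fderiv_param {x : Fin n → ℝ} (hx : x ∈ M.dom) (v : Fin n → ℝ) :
    S.logDeriv (M.param x) (fderiv ℝ M.param x v) = M.tangentLog S x v :=
  (S.logDerivCLM_apply (M.mem_states x hx) _).symm

theorem trMul_tangentLog {x : Fin n → ℝ} (hx : x ∈ M.dom) (v : Fin n → ℝ) :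
    trMul (M.param x) (M.tangentLog S x v) = 0 := by
  rw [← M.logDeriv_fderiv_param S hx, S.trMul_logDeriv (M.mem_states x hx), M.tr_fderiv_param hx]

theorem contDiffOn_tangentLog : ContDiffOn ℝ ∞ (M.tangentLog S) M.dom :=
  (S.contDiffOn_logDerivCLM.comp M.smooth M.mem_states).clm_comp M.contDiffOn_fderiv_param

/-- The metric of `M` as the map sending the components of a tangent vector to those of the
corresponding covector. -/
noncomputable def flat (x : Fin n → ℝ) : (Fin n → ℝ) →L[ℝ] (Fin n → ℝ) :=
  ContinuousLinearMap.pi fun j => trMulCLM (M.push (coordField j) x) ∘L M.tangentLog S x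

@[simp] theorem flat_apply (x v : Fin n → ℝ) (j : Fin n) :
    M.flat S x v j = trMul (M.push (coordField j) x) (M.tangentLog S x v) := rfl

theorem metric_fderiv_param {x : Fin n → ℝ} (hx : x ∈ M.dom) (v : Fin n → ℝ) (j : Fin n) :
    S.metric (M.param x) (fderiv ℝ M.param x v) (M.push (coordField j) x) = M.flat S x v j := by
  rw [S.metric_eq (M.mem_states x hx), M.logDeriv_fderiv_param S hx, flat_apply]

theorem trMul_fderiv_tangentLog (x v w : Fin n → ℝ) :
    trMul (fderiv ℝ M.param x v) (M.tangentLog S x w) = ∑ j, v j * M.flat S x w j := by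
  simp only [fderiv_param_apply, ← trMulCLM_apply, flat_apply, map_sum, map_smul,
    sum_apply, smul_apply, smul_eq_mul]

/-- A vector in the kernel has zero length; definiteness of the metric and the immersion property
then make it vanish. -/
theorem flat_injective {x : Fin n → ℝ} (hx : x ∈ M.dom) : Function.Injective (M.flat S x) := by
  rw [injective_iff_map_eq_zero]
  intro v hv
  have h : S.metric (M.param x) (fderiv ℝ M.param x v) (fderiv ℝ M.param x v) = 0 := by
    rw [S.metric_eq (M.mem_states x hx), M.logDeriv_fderiv_param S hx, trMul_fderiv_tangentLog, hv]
    simp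
  exact M.immersion x hx (by rw [S.eq_zero_of_metric_self (M.mem_states x hx) h, map_zero])

theorem exists_equiv_flat {x : Fin n → ℝ} (hx : x ∈ M.dom) :
    ∃ E : (Fin n → ℝ) ≃L[ℝ] (Fin n → ℝ), (E : (Fin n → ℝ) →L[ℝ] (Fin n → ℝ)) = M.flat S x :=
  ⟨(LinearEquiv.ofInjectiveEndo (M.flat S x).toLinearMap
    (M.flat_injective S hx)).toContinuousLinearEquiv, by ext; rfl⟩

theorem flat_inverse_apply {x : Fin n → ℝ} (hx : x ∈ M.dom) (v : Fin n → ℝ) :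
    M.flat S x ((M.flat S x).inverse v) = v := by
  obtain ⟨E, hE⟩ := M.exists_equiv_flat S hx
  simp [← hE]

theorem contDiffOn_flat : ContDiffOn ℝ ∞ (M.flat S) M.dom := by
  rw [contDiffOn_clm_apply]
  intro v
  rw [contDiffOn_pi]
  intro j
  exact ((contDiffOn_const (c := trMulCLM (H := H))).clm_apply
    (M.contDiffOn_push (M.isField_coordField j))).clm_apply
    ((M.contDiffOn_tangentLog S).clm_apply contDiffOn_const)

theorem contDiffOn_flat_inverse : ContDiffOn ℝ ∞ (fun x => (M.flat S x).inverse) M.dom := by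
  intro x hx
  obtain ⟨E, hE⟩ := M.exists_equiv_flat S hx
  have h1 : ContDiffAt ℝ ∞ ContinuousLinearMap.inverse (M.flat S x) := by
    rw [← hE]
    exact contDiffAt_map_inverse E
  exact h1.comp_contDiffWithinAt x (M.contDiffOn_flat S x hx)

theorem flat_eq_vecMul {x : Fin n → ℝ} (hx : x ∈ M.dom) (v : Fin n → ℝ) :
    M.flat S x v = Matrix.vecMul v (M.gram S x) := by
  ext j
  rw [← M.metric_fderiv_param S hx, S.metric_eq' (M.mem_states x hx), fderiv_param_apply]
  simp only [← trMulCLM_apply, map_sum, map_smul, sum_apply,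
    smul_apply, smul_eq_mul, Matrix.vecMul, dotProduct]
  refine Finset.sum_congr rfl fun i _ => ?_
  rw [gram, Matrix.of_apply, S.metric_eq' (M.mem_states x hx), trMulCLM_apply]

/-- The `i`-th row of the inverse Gram matrix consists of the components of the gradient of `ξ^i`:
its covector is `dξ^i`. -/
theorem flat_gram_inv {x : Fin n → ℝ} (hx : x ∈ M.dom) (i : Fin n) :
    M.flat S x ((M.gram S x)⁻¹ i) = Pi.single i 1 := by
  have hu : IsUnit (M.gram S x) := by
    rw [← Matrix.vecMul_injective_iff_isUnit]
    intro v w h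
    refine M.flat_injective S hx ?_
    rw [flat_eq_vecMul M S hx, flat_eq_vecMul M S hx]
    exact h
  rw [flat_eq_vecMul M S hx]
  have h := Matrix.nonsing_inv_mul (M.gram S x) ((Matrix.isUnit_iff_isUnit_det _).1 hu)
  ext j
  have h1 := congrFun (congrFun h i) j
  rw [Matrix.mul_apply] at h1
  rw [Matrix.vecMul, dotProduct, h1, Matrix.one_apply, Pi.single_apply]
  simp [eq_comm]

theorem inverse_flat_single {x : Fin n → ℝ} (hx : x ∈ M.dom) (i : Fin n) :
    (M.flat S x).inverse (Pi.single i 1) = (M.gram S x)⁻¹ i :=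
  M.flat_injective S hx (by rw [flat_inverse_apply M S hx, flat_gram_inv M S hx])

theorem L_eq_tangentLog {x : Fin n → ℝ} (hx : x ∈ M.dom) (i : Fin n) :
    M.L S i x = M.tangentLog S x (Pi.single i 1) :=
  M.logDeriv_fderiv_param S hx _

theorem tangentLog_eq_sum {x : Fin n → ℝ} (hx : x ∈ M.dom) (v : Fin n → ℝ) :
    M.tangentLog S x v = ∑ j, v j • M.L S j x := by
  rw [← M.logDeriv_fderiv_param S hx, ← S.logDerivCLM_apply (M.mem_states x hx),
    fderiv_param_apply, map_sum]
  refine Finset.sum_congr rfl fun j _ => ?_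
  rw [map_smul, S.logDerivCLM_apply (M.mem_states x hx), L]

/-- Pairing a tangent vector with `E^i`, the operator `L` of the gradient of `ξ^i`, evaluates `dξ^i`
on it. -/
theorem trMul_fderiv_tangentLog_gram_inv {x : Fin n → ℝ} (hx : x ∈ M.dom) (v : Fin n → ℝ)
    (i : Fin n) :
    trMul (fderiv ℝ M.param x v) (M.tangentLog S x ((M.gram S x)⁻¹ i)) = v i := by
  rw [trMul_fderiv_tangentLog, flat_gram_inv M S hx]
  simp [Pi.single_apply]

/-- In the dual frame the coefficients of a vector are its covariant components `g(v, ∂_i)`. The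
`E^i`, which (iii) makes explicit, thus carry the whole of `L_v`. -/
theorem tangentLog_eq_sum_flat {x : Fin n → ℝ} (hx : x ∈ M.dom) (v : Fin n → ℝ) :
    M.tangentLog S x v = ∑ i, M.flat S x v i • M.tangentLog S x ((M.gram S x)⁻¹ i) := by
  simp only [← map_smul, ← map_sum]
  congr 1
  refine M.flat_injective S hx ?_
  rw [map_sum]
  simp only [map_smul, flat_gram_inv M S hx]
  ext j
  simp [Pi.single_apply]

/-! ### The induced e-derivative in terms of `L`. -/

theorem tr_fderiv_push {Y : (Fin n → ℝ) → Fin n → ℝ} (hY : M.IsField Y) {x : Fin n → ℝ}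
    (hx : x ∈ M.dom) (v : Fin n → ℝ) : tr (fderiv ℝ (M.push Y) x v) = 0 := by
  have h1 : HasFDerivAt (fun y => trMul (M.push Y y) 1)
      (trMulCLM.flip 1 ∘L fderiv ℝ (M.push Y) x) x :=
    (trMulCLM.flip 1).hasFDerivAt.comp x (M.hasFDerivAt_push hY hx)
  have h2 : HasFDerivAt (fun y => trMul (M.push Y y) 1) (0 : (Fin n → ℝ) →L[ℝ] ℝ) x := by
    refine (hasFDerivAt_const (0 : ℝ) x).congr_of_eventuallyEq ?_
    filter_upwards [M.isOpen_dom.mem_nhds hx] with y hy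
    rw [trMul_one]
    exact M.tr_fderiv_param hy _
  have h3 := congrArg (fun f : (Fin n → ℝ) →L[ℝ] ℝ => f v) (h1.unique h2)
  rw [← trMul_one]
  simpa using h3

theorem tr_eDeriv {X Y : (Fin n → ℝ) → Fin n → ℝ} (hY : M.IsField Y) {x : Fin n → ℝ}
    (hx : x ∈ M.dom) : tr (M.eDeriv S X (M.push Y) x) = 0 := by
  have h := tr_add_smul (fderiv ℝ (M.push Y) x (X x)) (S.eCoeff (M.param x) (M.push X x) (M.push Y x)) 1
  rw [one_smul, M.tr_fderiv_push hY hx,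
    S.tr_eCoeff (M.mem_states x hx) (u := M.push X x) (M.tr_fderiv_param hx _)] at h
  simpa [eDeriv] using h

/-- Modulo the identity, `L` of the induced covariant derivative `∇⁽ᵉ⁾_X Y` is the derivative of
`L_Y` along `X`. -/
theorem exists_logDeriv_eDeriv {X Y : (Fin n → ℝ) → Fin n → ℝ} (hY : M.IsField Y)
    {x : Fin n → ℝ} (hx : x ∈ M.dom) :
    ∃ c : ℝ, S.logDeriv (M.param x) (M.eDeriv S X (M.push Y) x) =
      fderiv ℝ (fun y => M.tangentLog S y (Y y)) x (X x) + c • (1 : Herm H) := by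
  have hρ := M.mem_states x hx
  have hG := ((S.contDiffOn_logDerivCLM _ hρ).differentiableWithinAt (by simp)).hasFDerivWithinAt
  obtain ⟨c, hc⟩ := S.exists_logDeriv_eCoeff (v := M.push Y x) hρ (M.tr_fderiv_param hx (X x)) hG
  have h1 := (hG.comp x (M.differentiableAt_param hx).hasFDerivAt.hasFDerivWithinAt
    (s := M.dom) M.mem_states).hasFDerivAt (M.isOpen_dom.mem_nhds hx)
  -- Product rule: one term is `L` of the derivative of `Y`, the other is the derivative of `L`
  -- applied to `Y`, which is `L` of the coefficient term modulo `I`.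
  have h2 : HasFDerivAt (fun y => M.tangentLog S y (Y y)) _ x := h1.clm_apply (M.hasFDerivAt_push hY hx)
  refine ⟨c, ?_⟩
  rw [h2.fderiv, eDeriv, ← S.logDerivCLM_apply hρ, map_add, S.logDerivCLM_apply hρ (S.eCoeff _ _ _),
    push, hc]
  simp [push, add_assoc]

/-- Tangency may be checked modulo `I`: both operators `L` have expectation zero, so they agree once
they agree up to a multiple of `I`. -/
theorem eDeriv_eq_push {X Y : (Fin n → ℝ) → Fin n → ℝ} (hY : M.IsField Y)
    {x : Fin n → ℝ} (hx : x ∈ M.dom) {z : Fin n → ℝ} {c : ℝ}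
    (h : fderiv ℝ (fun y => M.tangentLog S y (Y y)) x (X x) =
      M.tangentLog S x z + c • (1 : Herm H)) :
    M.eDeriv S X (M.push Y) x = fderiv ℝ M.param x z := by
  obtain ⟨d, hd⟩ := M.exists_logDeriv_eDeriv S (X := X) hY hx
  have hρ := M.mem_states x hx
  refine S.logDeriv_injective hρ ?_
  rw [M.logDeriv_fderiv_param S hx]
  refine eq_of_eq_add_smul_one (c := c + d) hρ ?_ ?_
  · rw [hd, h, add_smul, add_assoc]
  · rw [S.trMul_logDeriv hρ, M.tr_eDeriv S hY hx, M.trMul_tangentLog S hx]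

theorem sum_gram_inv_smul_L {x : Fin n → ℝ} (hx : x ∈ M.dom) (i : Fin n) :
    ∑ j, (M.gram S x)⁻¹ i j • M.L S j x = M.tangentLog S x ((M.gram S x)⁻¹ i) :=
  (M.tangentLog_eq_sum S hx _).symm

theorem isField_gram_inv (i : Fin n) : M.IsField fun x => (M.gram S x)⁻¹ i :=
  ((M.contDiffOn_flat_inverse S).clm_apply
    (contDiffOn_const (c := (Pi.single i 1 : Fin n → ℝ)))).congr fun _ hx =>
      (M.inverse_flat_single S hx i).symm

theorem trMul_fderiv_smul_one {x : Fin n → ℝ} (hx : x ∈ M.dom) (v : Fin n → ℝ) (c : ℝ) :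
    trMul (fderiv ℝ M.param x v) (c • (1 : Herm H)) = 0 := by
  rw [trMul_smul_right, trMul_one, M.tr_fderiv_param hx, mul_zero]

/-! ### The implications between the four conditions. -/

section Conditions

variable {F : Fin n → Herm H}

theorem expectation_eq_coord
    (hF : ∀ i, ∀ x ∈ M.dom,
      ∑ j, (M.gram S x)⁻¹ i j • M.L S j x = F i - x i • (1 : Herm H)) (i : Fin n)
    {x : Fin n → ℝ} (hx : x ∈ M.dom) : x i = trMul (M.param x) (F i) := by
  have h := congrArg (trMul (M.param x)) (hF i x hx)
  rw [M.sum_gram_inv_smul_L S hx, M.trMul_tangentLog S hx, trMul_sub_right, trMul_smul_right,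
    trMul_one_of_mem_states (M.mem_states x hx)] at h
  linarith

theorem exists_coord_of_expectation
    (hF : ∀ i, ∀ x ∈ M.dom,
      ∑ j, (M.gram S x)⁻¹ i j • M.L S j x =
        F i - trMul (M.param x) (F i) • (1 : Herm H)) :
    ∃ F : Fin n → Herm H, ∀ i, ∀ x ∈ M.dom,
      ∑ j, (M.gram S x)⁻¹ i j • M.L S j x = F i - x i • (1 : Herm H) := by
  obtain ⟨x₀, hx₀⟩ := M.isConnected_dom.nonempty
  have hd : ∀ i, ∀ x ∈ M.dom, HasFDerivAt (fun y => trMul (M.param y) (F i) - y i)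
      (0 : (Fin n → ℝ) →L[ℝ] ℝ) x := by
    intro i x hx
    have h := (M.hasFDerivAt_trMul_param hx (F i)).sub
      (ContinuousLinearMap.proj (R := ℝ) (φ := fun _ : Fin n => ℝ) i).hasFDerivAt
    refine h.congr_fderiv ?_
    ext v
    have h1 := M.trMul_fderiv_tangentLog_gram_inv S hx v i
    -- The multiple of `I` pairs to zero with tangent vectors, so `d⟨F^i⟩(v) = v i`.
    rw [← M.sum_gram_inv_smul_L S hx, hF i x hx, trMul_sub_right, M.trMul_fderiv_smul_one hx,
      sub_zero] at h1
    simp [h1]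
  -- The constant `⟨F^i⟩ - ξ^i`, evaluated at a base point, is moved into `F^i`.
  refine ⟨fun i => F i - (trMul (M.param x₀) (F i) - x₀ i) • (1 : Herm H), fun i x hx => ?_⟩
  have hc : trMul (M.param x) (F i) - x i = trMul (M.param x₀) (F i) - x₀ i :=
    M.isOpen_dom.is_const_of_fderiv_eq_zero M.isConnected_dom.isPreconnected
      (fun y hy => (hd i y hy).differentiableAt.differentiableWithinAt)
      (fun y hy => (hd i y hy).fderiv) hx hx₀
  simp only [hF i x hx, ← hc, sub_smul]
  abel

theorem L_mem_span
    (hF : ∀ i, ∀ x ∈ M.dom,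
      ∑ j, (M.gram S x)⁻¹ i j • M.L S j x = F i - x i • (1 : Herm H)) (i : Fin n)
    {x : Fin n → ℝ} (hx : x ∈ M.dom) :
    M.L S i x ∈ Submodule.span ℝ (Set.range F) ⊔ Submodule.span ℝ {1} := by
  rw [L_eq_tangentLog M S hx, tangentLog_eq_sum_flat M S hx]
  refine Submodule.sum_mem _ fun j _ => Submodule.smul_mem _ _ ?_
  rw [← M.sum_gram_inv_smul_L S hx, hF j x hx]
  exact Submodule.sub_mem _
    (Submodule.mem_sup_left (Submodule.subset_span ⟨j, rfl⟩))
    (Submodule.mem_sup_right (Submodule.smul_mem _ _ (Submodule.mem_span_singleton_self _)))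

theorem trMul_fderiv_of_expectation (hF : ∀ i, ∀ x ∈ M.dom, x i = trMul (M.param x) (F i))
    {x : Fin n → ℝ} (hx : x ∈ M.dom) (v : Fin n → ℝ) (i : Fin n) :
    trMul (fderiv ℝ M.param x v) (F i) = v i := by
  have h1 := M.hasFDerivAt_trMul_param hx (F i)
  have h2 : HasFDerivAt (fun y => trMul (M.param y) (F i))
      (ContinuousLinearMap.proj (R := ℝ) (φ := fun _ : Fin n => ℝ) i) x := by
    refine (ContinuousLinearMap.hasFDerivAt _).congr_of_eventuallyEq ?_
    filter_upwards [M.isOpen_dom.mem_nhds hx] with y hy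
    exact (hF i y hy).symm
  simpa using congrArg (fun f : (Fin n → ℝ) →L[ℝ] ℝ => f v) (h1.unique h2)

/-- Differentiating `ξ^j = ⟨F^j⟩` makes the `F^j` dual to the `∂_k`, so coefficients are recovered
by pairing. -/
theorem trMul_fderiv_sum_of_expectation (hF : ∀ i, ∀ x ∈ M.dom, x i = trMul (M.param x) (F i))
    {x : Fin n → ℝ} (hx : x ∈ M.dom) (a : Fin n → ℝ) (k : Fin n) :
    trMul (M.push (coordField k) x) (∑ j, a j • F j) = a k := by
  simp only [trMul_sum_right, trMul_smul_right, push, M.trMul_fderiv_of_expectation hF hx]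
  simp [coordField, Pi.single_apply]

theorem sum_gram_inv_smul_L_of_mem_span
    (hF : ∀ i, ∀ x ∈ M.dom,
      M.L S i x ∈ Submodule.span ℝ (Set.range F) ⊔ Submodule.span ℝ {1} ∧
        x i = trMul (M.param x) (F i)) (i : Fin n)
    {x : Fin n → ℝ} (hx : x ∈ M.dom) :
    ∑ j, (M.gram S x)⁻¹ i j • M.L S j x = F i - x i • (1 : Herm H) := by
  have hmem : ∑ j, (M.gram S x)⁻¹ i j • M.L S j x ∈
      Submodule.span ℝ (Set.range F) ⊔ Submodule.span ℝ {1} :=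
    Submodule.sum_mem _ fun j _ => Submodule.smul_mem _ _ (hF j x hx).1
  obtain ⟨A, hA, B, hB, hAB⟩ := Submodule.mem_sup.1 hmem
  obtain ⟨a, rfl⟩ := (Submodule.mem_span_range_iff_exists_fun ℝ).1 hA
  obtain ⟨b, rfl⟩ := Submodule.mem_span_singleton.1 hB
  have hξ : ∀ i, ∀ x ∈ M.dom, x i = trMul (M.param x) (F i) := fun i x hx => (hF i x hx).2
  -- `E^i` and its expansion are both paired with `∂_k`; the multiple of `I` drops out. The
  -- remaining scalar `b` is then determined by expectations.
  have ha : a = Pi.single i 1 := by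
    ext k
    have h := congrArg (trMul (M.push (coordField k) x)) hAB
    rw [trMul_add_right, M.trMul_fderiv_sum_of_expectation hξ hx, push,
      M.trMul_fderiv_smul_one hx, add_zero, M.sum_gram_inv_smul_L S hx,
      M.trMul_fderiv_tangentLog_gram_inv S hx] at h
    rw [h, coordField, Pi.single_apply, Pi.single_apply]
    simp [eq_comm]
  rw [← hAB, ha]
  refine eq_of_eq_add_smul_one (ρ := M.param x) (c := b + x i) (M.mem_states x hx) ?_ ?_
  · simp [Pi.single_apply, add_smul]
  · rw [← ha, hAB, M.sum_gram_inv_smul_L S hx, M.trMul_tangentLog S hx, trMul_sub_right,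
      trMul_smul_right, trMul_one_of_mem_states (M.mem_states x hx), ← hξ i x hx]
    ring

theorem disjoint_span_one (hF : ∀ i, ∀ x ∈ M.dom, x i = trMul (M.param x) (F i)) :
    Disjoint (Submodule.span ℝ (Set.range F)) (Submodule.span ℝ {(1 : Herm H)}) := by
  obtain ⟨x, hx⟩ := M.isConnected_dom.nonempty
  rw [Submodule.disjoint_def]
  intro A hA hB
  obtain ⟨a, rfl⟩ := (Submodule.mem_span_range_iff_exists_fun ℝ).1 hA
  obtain ⟨b, hb⟩ := Submodule.mem_span_singleton.1 hB
  have ha : a = 0 := by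
    ext k
    rw [← M.trMul_fderiv_sum_of_expectation hF hx a k, ← hb, push, M.trMul_fderiv_smul_one hx]
    rfl
  simp [ha]

theorem isEAutoparallel_and_isMAffine
    (hF : ∀ i, ∀ x ∈ M.dom,
      ∑ j, (M.gram S x)⁻¹ i j • M.L S j x = F i - x i • (1 : Herm H)) :
    M.IsEAutoparallel S ∧ M.IsMAffine S := by
  have hE : ∀ i, ∀ x ∈ M.dom,
      M.tangentLog S x ((M.gram S x)⁻¹ i) = F i - x i • (1 : Herm H) := fun i x hx => by
    rw [← M.sum_gram_inv_smul_L S hx, hF i x hx]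
  have hflat : ∀ Y, M.IsField Y → ContDiffOn ℝ ∞ (fun x => M.flat S x (Y x)) M.dom :=
    fun Y hY => (M.contDiffOn_flat S).clm_apply hY
  have hflat' : ∀ Y, M.IsField Y → ∀ x ∈ M.dom, HasFDerivAt (fun x => M.flat S x (Y x))
      (fderiv ℝ (fun x => M.flat S x (Y x)) x) x := fun Y hY x hx =>
    (((hflat Y hY).contDiffAt (M.isOpen_dom.mem_nhds hx)).differentiableAt (by simp)).hasFDerivAt
  have key : ∀ X Y, M.IsField Y → ∀ x ∈ M.dom, M.eDeriv S X (M.push Y) x =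
      fderiv ℝ M.param x ((M.flat S x).inverse (fderiv ℝ (fun x => M.flat S x (Y x)) x (X x))) := by
    intro X Y hY x hx
    -- The constant collects the derivatives of the factors `-ξ^i I` in `∑ Y_i (F^i - ξ^i I)`, each
    -- contributing `-Y_i X^i`.
    refine M.eDeriv_eq_push S hY hx (c := -∑ i, M.flat S x (Y x) i * X x i) ?_
    have h1 : ∀ i, HasFDerivAt (fun y => M.flat S y (Y y) i • (F i - y i • (1 : Herm H))) _ x :=
      fun i => (hasFDerivAt_pi'.1 (hflat' Y hY x hx) i).smul
        (((ContinuousLinearMap.proj (R := ℝ) (φ := fun _ : Fin n => ℝ) i).hasFDerivAt.smul_const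
          (1 : Herm H)).const_sub (F i))
    have h2 := HasFDerivAt.fun_sum (u := Finset.univ) fun i _ => h1 i
    have h3 := h2.congr_of_eventuallyEq (f₁ := fun y => M.tangentLog S y (Y y)) (by
      filter_upwards [M.isOpen_dom.mem_nhds hx] with y hy
      rw [tangentLog_eq_sum_flat M S hy]
      exact Finset.sum_congr rfl fun i _ => by rw [hE i y hy])
    rw [h3.fderiv, tangentLog_eq_sum_flat M S hx, flat_inverse_apply M S hx, ← Finset.sum_neg_distrib,
      Finset.sum_smul, ← Finset.sum_add_distrib, sum_apply]
    refine Finset.sum_congr rfl fun i _ => ?_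
    rw [hE i x hx]
    simp [mul_smul, add_comm]
  refine ⟨fun X Y hX hY => ⟨_, (M.contDiffOn_flat_inverse S).clm_apply
    (((hflat Y hY).fderiv_of_isOpen M.isOpen_dom (by simp)).clm_apply hX), key X Y hY⟩,
    fun j X hX => ⟨contDiffOn_const, fun Y hY x hx => ?_⟩⟩
  have h0 : S.metric (M.param x) (M.push Y x) (M.push 0 x) = 0 := by
    rw [S.metric_eq' (M.mem_states x hx), push, push, M.logDeriv_fderiv_param S hx]
    rw [Pi.zero_apply, map_zero (M.tangentLog S x), ← trMulLin_apply, map_zero (trMulLin _)]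
  have h1 : HasFDerivAt (fun y => S.metric (M.param y) (M.push Y y) (M.push (coordField j) y))
      (ContinuousLinearMap.proj (R := ℝ) (φ := fun _ : Fin n => ℝ) j ∘L
        fderiv ℝ (fun x => M.flat S x (Y x)) x) x := by
    refine (hasFDerivAt_pi'.1 (hflat' Y hY x hx) j).congr_of_eventuallyEq ?_
    filter_upwards [M.isOpen_dom.mem_nhds hx] with y hy
    exact M.metric_fderiv_param S hy _ j
  -- Both sides are the derivative along `X` of the covariant component `Y_j`.
  rw [h0, add_zero, h1.fderiv, key X Y hY x hx, M.metric_fderiv_param S hx,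
    flat_inverse_apply M S hx]
  rfl

theorem exists_expectation_of_isMAffine (ha : M.IsEAutoparallel S) (hm : M.IsMAffine S) :
    ∃ F : Fin n → Herm H, ∀ i, ∀ x ∈ M.dom,
      ∑ j, (M.gram S x)⁻¹ i j • M.L S j x =
        F i - trMul (M.param x) (F i) • (1 : Herm H) := by
  obtain ⟨x₀, hx₀⟩ := M.isConnected_dom.nonempty
  have hρ₀ := M.mem_states x₀ hx₀
  let E : Fin n → (Fin n → ℝ) → Herm H := fun i x => M.tangentLog S x ((M.gram S x)⁻¹ i)
  have hEd : ∀ i, ∀ x ∈ M.dom, HasFDerivAt (E i) (fderiv ℝ (E i) x) x := fun i x hx =>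
    ((((M.contDiffOn_tangentLog S).clm_apply (M.isField_gram_inv S i)).contDiffAt
      (M.isOpen_dom.mem_nhds hx)).differentiableAt (by simp)).hasFDerivAt
  have hE' : ∀ i, ∀ x ∈ M.dom, ∀ v, ∃ c : ℝ, fderiv ℝ (E i) x v = c • (1 : Herm H) := by
    intro i x hx v
    have hX : M.IsField fun _ => v := contDiffOn_const
    obtain ⟨Z, -, hZ⟩ := ha (fun _ => v) _ hX (M.isField_gram_inv S i)
    -- With `Y` the gradient of `ξ^i`, the functions `g(Y, ∂_j)` are constant and the m-derivative
    -- of `∂_j` is zero. Duality therefore kills every covariant component of `∇⁽ᵉ⁾_X Y`.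
    have hz : Z x = 0 := by
      refine M.flat_injective S hx ?_
      rw [map_zero]
      ext j
      have h := (hm j _ hX).2 _ (M.isField_gram_inv S i) x hx
      have h0 : S.metric (M.param x) (M.push (fun x => (M.gram S x)⁻¹ i) x) (M.push 0 x) = 0 := by
        rw [S.metric_eq' (M.mem_states x hx), push, push, M.logDeriv_fderiv_param S hx]
        rw [Pi.zero_apply, map_zero (M.tangentLog S x), ← trMulLin_apply, map_zero (trMulLin _)]
      have h1 : HasFDerivAt (fun y => S.metric (M.param y)
          (M.push (fun x => (M.gram S x)⁻¹ i) y) (M.push (coordField j) y))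
          (0 : (Fin n → ℝ) →L[ℝ] ℝ) x := by
        refine (hasFDerivAt_const ((Pi.single i 1 : Fin n → ℝ) j) x).congr_of_eventuallyEq ?_
        filter_upwards [M.isOpen_dom.mem_nhds hx] with y hy
        rw [push, M.metric_fderiv_param S hy, flat_gram_inv M S hy]
      rw [h0, h1.fderiv, hZ x hx, push, M.metric_fderiv_param S hx, add_zero] at h
      exact h.symm
    obtain ⟨c, hc⟩ := M.exists_logDeriv_eDeriv S (X := fun _ => v) (M.isField_gram_inv S i) hx
    rw [hZ x hx, push, hz, M.logDeriv_fderiv_param S hx, map_zero] at hc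
    exact ⟨-c, by rw [neg_smul]; exact eq_neg_of_add_eq_zero_left hc.symm⟩
  refine ⟨fun i => E i x₀, fun i x hx => ?_⟩
  -- Projection along `I` onto the operators of expectation zero at the base point. It kills the
  -- derivatives of `E^i`, so `P ∘ E^i` is constant, with value `E^i` at the base point.
  let P : Herm H →L[ℝ] Herm H :=
    ContinuousLinearMap.id ℝ _ - (trMulCLM (M.param x₀)).smulRight (1 : Herm H)
  have hP : ∀ A, P A = A - trMul (M.param x₀) A • (1 : Herm H) := fun _ => rfl
  have hd : ∀ y ∈ M.dom, HasFDerivAt (fun y => P (E i y)) (0 : (Fin n → ℝ) →L[ℝ] Herm H) y := by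
    intro y hy
    refine (P.hasFDerivAt.comp y (hEd i y hy)).congr_fderiv ?_
    ext1 v
    obtain ⟨c, hc⟩ := hE' i y hy v
    rw [ContinuousLinearMap.comp_apply, hc, hP, trMul_smul_right, trMul_one_of_mem_states hρ₀]
    simp
  have hconst : P (E i x) = P (E i x₀) :=
    M.isOpen_dom.is_const_of_fderiv_eq_zero M.isConnected_dom.isPreconnected
      (fun y hy => (hd y hy).differentiableAt.differentiableWithinAt)
      (fun y hy => (hd y hy).fderiv) hx hx₀
  have h0 : trMul (M.param x₀) (E i x₀) = 0 := M.trMul_tangentLog S hx₀ _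
  rw [hP, hP, h0, zero_smul, sub_zero] at hconst
  rw [M.sum_gram_inv_smul_L S hx]
  have hρ := M.mem_states x hx
  refine eq_of_eq_add_smul_one (ρ := M.param x) hρ (A := E i x)
    (B := E i x₀ - trMul (M.param x) (E i x₀) • 1)
    (c := trMul (M.param x₀) (E i x) + trMul (M.param x) (E i x₀)) ?_ ?_
  · rw [add_smul, add_comm (_ • (1 : Herm H)), ← add_assoc, sub_add_cancel]
    exact sub_eq_iff_eq_add.1 hconst
  · rw [trMul_sub_right, trMul_smul_right, trMul_one_of_mem_states hρ]
    exact (M.trMul_tangentLog S hx _).trans (by ring)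

end Conditions

end Model

end QuantumModel

theorem mainTheorem6 {H : Type*} [NormedAddCommGroup H] [InnerProductSpace ℂ H] [CompleteSpace H]
    [FiniteDimensional ℂ H] (S : QuantumModel.InnerFamily H) {n : ℕ}
    (M : QuantumModel.Model H n) :
    List.TFAE
      [ M.IsEAutoparallel S ∧ M.IsMAffine S,
        ∃ F : Fin n → QuantumModel.Herm H, ∀ i, ∀ x ∈ M.dom,
          ∑ j, (M.gram S x)⁻¹ i j • M.L S j x =
            F i - QuantumModel.trMul (M.param x) (F i) • (1 : QuantumModel.Herm H),
        ∃ F : Fin n → QuantumModel.Herm H, ∀ i, ∀ x ∈ M.dom,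
          ∑ j, (M.gram S x)⁻¹ i j • M.L S j x = F i - x i • (1 : QuantumModel.Herm H),
        ∃ F : Fin n → QuantumModel.Herm H, ∀ i, ∀ x ∈ M.dom,
          M.L S i x ∈ Submodule.span ℝ (Set.range F) ⊔ Submodule.span ℝ {1} ∧
            x i = QuantumModel.trMul (M.param x) (F i) ] ∧
    (∀ F : Fin n → QuantumModel.Herm H,
      (∀ i, ∀ x ∈ M.dom,
        ∑ j, (M.gram S x)⁻¹ i j • M.L S j x = F i - x i • (1 : QuantumModel.Herm H)) →
      ∀ i, ∀ x ∈ M.dom, x i = QuantumModel.trMul (M.param x) (F i)) ∧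
    (∀ F : Fin n → QuantumModel.Herm H,
      (∀ i, ∀ x ∈ M.dom,
        M.L S i x ∈ Submodule.span ℝ (Set.range F) ⊔ Submodule.span ℝ {1} ∧
          x i = QuantumModel.trMul (M.param x) (F i)) →
      Disjoint (Submodule.span ℝ (Set.range F))
        (Submodule.span ℝ {(1 : QuantumModel.Herm H)})) := by
  refine ⟨?_, fun F hF i x hx => M.expectation_eq_coord S hF i hx,
    fun F hF => M.disjoint_span_one fun i x hx => (hF i x hx).2⟩
  tfae_have 1 → 2 := fun h => M.exists_expectation_of_isMAffine S h.1 h.2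
  tfae_have 2 → 3 := fun ⟨_, hF⟩ => M.exists_coord_of_expectation S hF
  tfae_have 3 → 1 := fun ⟨_, hF⟩ => M.isEAutoparallel_and_isMAffine S hF
  tfae_have 3 → 4 := fun ⟨F, hF⟩ =>
    ⟨F, fun i _ hx => ⟨M.L_mem_span S hF i hx, M.expectation_eq_coord S hF i hx⟩⟩
  tfae_have 4 → 3 := fun ⟨F, hF⟩ =>
    ⟨F, fun i _ hx => M.sum_gram_inv_smul_L_of_mem_span S hF i hx⟩
  tfae_finish
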